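/- Let $G$ be a simple graph on the vertex set $[0,n]$, with every edge $(j,i)$ directed from the smaller vertex $j$ to the larger vertex $i$; let $G\backslash 0$ be $G$ with the vertex $0$ deleted, and let $F\subseteq E(G\backslash 0)$. Put $f_{i,j}=\#\{(j,k)\in F: k\le i\}$ and $b_i=\mathrm{indeg}_G(i)-\mathrm{outdeg}_F(i)$ for $i\in[n]$, and let $G[0,i]$ be the restriction of $G$ to the vertices $0,\dots,i$. Let $\mathrm{Sol}_G(F)$ be the set of integer arrays $(a_{i,j})_{1\le j\le i\le n}$ such that $a_{n,j}\ge 0$ for all $j\in[n]$; for $1\le j<i\le n$, $a_{i,j}+f_{i,j}\le a_{i-1,j}+f_{i-1,j}$ if $(j,i)\in E(G)$, with equality if $(j,i)\notin E(G)$; and $a_{i,i}=\#E(G[0,i])-\sum_{k<i}(a_{i,k}+f_{i,k})$ for $i\in[n]$. Let $\mathrm{LD}(G,F)$ be the multiset of the sequences $(a_{n,1},\dots,a_{n,n})$ for the arrays in $\mathrm{Sol}_G(F)$ (the left-degree sequences of $G$ belonging to $F$), and let $$L_{G,F}(t)=\sum_{\alpha\in \mathrm{LD}(G,F)}(-1)^{\#E(G)-\sum_i\alpha_i}\,t^\alpha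 .$$ Consider the graph on $[n]\cup\{t\}$ whose edges are those of $G\backslash 0$ together with $(j,t)$ for $j\in[n]$. A flow is an assignment $f$ of nonnegative real numbers to its edges such that outflow minus inflow is $b_i$ at each $i\in[n]$ and $-\#E(G\backslash F)$ at $t$, where $G\backslash F$ is $G$ with the edges in $F$ deleted. If there is a flow, put $z_I^F=\min_f\sum_{i\in I}f(i,t)$ for $I\subseteq[n]$, the minimum being over all flows $f$, and $$P_n^z\{z_I^F\}=\Big\{x\in\mathbb R^n:\ \sum_{i\in I}x_i\ge z_I^F\ \text{ for } I\ne[n],\quad \sum_{i=1}^n x_i=z_{[n]}^F\Big\}.$$ Then the following hold. 1. $\mathrm{Newton}(L_{G,F})=\mathrm{Conv}(\mathrm{LD}(G,F))$, and $L_{G,F}$ has polytopal support: every integer point of $\mathrm{Newton}(L_{G,F})$ is the exponent of a monomial of $L_{G,F}$ with nonzero coefficient. 2. If there is no flow, then $\mathrm{LD}(G,F)$ is empty. If there is a flow, then all the minima $z_I^F$ are attained; $z_\emptyset^F=0$ and $z^F_{I\cup J}+z^F_{I\cap J}\ge z^F_I+z^F_J$ for all $I,J\subseteq[n]$; $\mathrm{Newton}(L_{G,F})$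 is the generalized permutahedron $P_n^z\{z_I^F\}$; and every integer point of $P_n^z\{z_I^F\}$ is in $\mathrm{LD}(G,F)$. 3. Suppose that $b_i\ge 0$ for all $i\in[n]$ (for example, $F=\emptyset$, where $b_i=\mathrm{indeg}_G(i)$). Then there is a flow. Let $\Delta_I=\mathrm{Conv}\{e_i:i\in I\}$ for nonempty $I\subseteq[n]$ and $\Delta_\emptyset=\{0\}$. Let $\mathcal L$ be the lattice of all $J\subseteq[n]$ such that no edge of $G$ goes from a vertex in $J$ to a vertex outside $J$. For $J\subseteq[n]$ put $y_J^F=b_k$ if $J$ is a join-irreducible element of $\mathcal L$, $J'$ is the element of $\mathcal L$ that it covers, and $J\setminus J'=\{k\}$; put $y_J^F=0$ if $J$ is not a join-irreducible element of $\mathcal L$. Let $\delta(i)$ be the set of vertices that can be reached from $i$ by an increasing path in $G$, including $i$ itself. Then, with Minkowski sums, $$\sum_{J\subseteq[n]}y_J^F\,\Delta_J=P_n^z\{z_I^F\}\qquad\text{and}\qquad \mathrm{Newton}(L_{G,F})=\sum_{i=1}^n b_i\,\Delta_{\delta(i)} .$$ -/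

import Mathlib

namespace LeftDegree

open Finset
open scoped Pointwise

noncomputable section

/-! A simple graph on the vertex set `[0,n]` is a `SimpleGraph (Fin (n + 1))`; its edges are directed
from the smaller to the larger vertex. The vertices `1, …, n` are indexed by `Fin n`: the index
`i : Fin n` stands for the vertex `i.succ`. -/

open Classical in
/-- The directed edges of `G`. -/
def arcs {n : ℕ} (G : SimpleGraph (Fin (n + 1))) : Finset (Fin (n + 1) × Fin (n + 1)) :=
  univ.filter fun e => e.1 < e.2 ∧ G.Adj e.1 e.2

open Classical in
/-- The directed edges of `G \ 0`, that is `G` with the vertex `0` deleted. -/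
def arcsWithoutZero {n : ℕ} (G : SimpleGraph (Fin (n + 1))) : Finset (Fin n × Fin n) :=
  univ.filter fun e => e.1 < e.2 ∧ G.Adj e.1.succ e.2.succ

/-- The indegree in `G` of a vertex in `[n]`. -/
def indeg {n : ℕ} (G : SimpleGraph (Fin (n + 1))) (i : Fin n) : ℕ :=
  #((arcs G).filter fun e => e.2 = i.succ)

/-- The outdegree of a vertex in a set `F` of edges of `G \ 0`. -/
def outdeg {n : ℕ} (F : Finset (Fin n × Fin n)) (i : Fin n) : ℕ :=
  #(F.filter fun e => e.1 = i)

/-- The number of edges of `G[0,i]`, the restriction of `G` to the vertices `0, …, i`. -/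
def numArcsUpTo {n : ℕ} (G : SimpleGraph (Fin (n + 1))) (i : Fin n) : ℕ :=
  #((arcs G).filter fun e => e.2 ≤ i.succ)

/-- The number `f_{i,j}` of edges `(j,k)` in `F` with `k ≤ i`. -/
def shift {n : ℕ} (F : Finset (Fin n × Fin n)) (i j : Fin n) : ℕ :=
  #(F.filter fun e => e.1 = j ∧ e.2 ≤ i)

/-! ### Triangular constraint arrays and left-degree sequences -/

/-- `Sol_G(F)`: the integer solutions `(a_{i,j})`, `1 ≤ j ≤ i ≤ n`, of the constraint array `Tri_G(F)`,
which arises from `Tri_G(∅)` by replacing each `a_{i,j}` by `a_{i,j} + f_{i,j}` and each leftmost `0`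
by `f_{n,j}`. Arrays are extended by zero to the positions `j > i` (`zero_ext`). The case `i = 1` of
`diag` is the constraint `a_{1,1} = #E(G[0,1])`. -/
structure IsSol {n : ℕ} (G : SimpleGraph (Fin (n + 1))) (F : Finset (Fin n × Fin n))
    (a : Fin n → Fin n → ℤ) : Prop where
  zero_ext : ∀ i j, i < j → a i j = 0
  left : ∀ l j : Fin n, (l : ℕ) + 1 = n → (shift F l j : ℤ) ≤ a l j + shift F l j
  step_le : ∀ i' i j : Fin n, (i' : ℕ) + 1 = i → j ≤ i' → (j, i) ∈ arcsWithoutZero G →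
    a i j + shift F i j ≤ a i' j + shift F i' j
  step_eq : ∀ i' i j : Fin n, (i' : ℕ) + 1 = i → j ≤ i' → (j, i) ∉ arcsWithoutZero G →
    a i j + shift F i j = a i' j + shift F i' j
  diag : ∀ i : Fin n,
    a i i + shift F i i = numArcsUpTo G i - ∑ k ∈ univ.filter (· < i), (a i k + shift F i k)

theorem IsSol.antitone {n : ℕ} {G : SimpleGraph (Fin (n + 1))} {F : Finset (Fin n × Fin n)}
    {a : Fin n → Fin n → ℤ} (h : IsSol G F a) (j : Fin n) (d : ℕ) :
    ∀ i m : Fin n, (i : ℕ) + d = m → j ≤ i → a m j + shift F m j ≤ a i j + shift F i j := by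
  induction d with
  | zero =>
    intro i m hd _
    have : i = m := Fin.ext (by simpa using hd)
    rw [this]
  | succ d ih =>
    intro i m hd hj
    have hlt : (i : ℕ) + d < n := by have := m.2; omega
    have hj' : j ≤ (⟨i + d, hlt⟩ : Fin n) := by
      rw [Fin.le_def] at hj ⊢; simp only; omega
    have h1 := ih i ⟨i + d, hlt⟩ rfl hj
    have h2 : a m j + shift F m j ≤ a ⟨i + d, hlt⟩ j + shift F ⟨i + d, hlt⟩ j := by
      by_cases hm : (j, m) ∈ arcsWithoutZero G
      · exact h.step_le ⟨i + d, hlt⟩ m j (by simp only; omega) hj' hm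
      · exact (h.step_eq ⟨i + d, hlt⟩ m j (by simp only; omega) hj' hm).le
    exact h2.trans h1

theorem IsSol.nonneg {n : ℕ} {G : SimpleGraph (Fin (n + 1))} {F : Finset (Fin n × Fin n)}
    {a : Fin n → Fin n → ℤ} (h : IsSol G F a) (i j : Fin n) (hj : j ≤ i) : 0 ≤ a i j := by
  have hn : n - 1 < n := by have := i.2; omega
  have h1 := h.antitone j (n - 1 - i) i ⟨n - 1, hn⟩ (by have := i.2; simp only; omega) hj
  have h2 := h.left ⟨n - 1, hn⟩ j (by simp only; omega)
  have h3 : shift F i j ≤ shift F ⟨n - 1, hn⟩ j := by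
    refine card_le_card fun e he => ?_
    simp only [mem_filter] at he ⊢
    refine ⟨he.1, he.2.1, ?_⟩
    rw [Fin.le_def]; simp only
    have := e.2.2; omega
  omega

theorem IsSol.le {n : ℕ} {G : SimpleGraph (Fin (n + 1))} {F : Finset (Fin n × Fin n)}
    {a : Fin n → Fin n → ℤ} (h : IsSol G F a) (i j : Fin n) : a i j ≤ #(arcs G) := by
  rcases lt_or_ge i j with hij | hij
  · rw [h.zero_ext i j hij]; positivity
  · have h1 := h.antitone j (i - j) j i (by rw [Fin.le_def] at hij; omega) le_rfl
    have h2 := h.diag j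
    have h3 : (0 : ℤ) ≤ ∑ k ∈ univ.filter (· < j), (a j k + shift F j k) := by
      refine sum_nonneg fun k hk => ?_
      have := h.nonneg j k (mem_filter.1 hk).2.le
      positivity
    have h4 : numArcsUpTo G j ≤ #(arcs G) := card_le_card (filter_subset _ _)
    omega

theorem finite_isSol {n : ℕ} (G : SimpleGraph (Fin (n + 1))) (F : Finset (Fin n × Fin n)) :
    {a | IsSol G F a}.Finite := by
  refine (Set.finite_Icc (fun _ _ => 0 : Fin n → Fin n → ℤ) (fun _ _ => (#(arcs G) : ℤ))).subset ?_
  intro a (ha : IsSol G F a)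
  refine ⟨fun i j => ?_, fun i j => ha.le i j⟩
  rcases lt_or_ge i j with hij | hij
  · exact (ha.zero_ext i j hij).ge
  · exact ha.nonneg i j hij

/-- The finite set `Sol_G(F)`. -/
def sol {n : ℕ} (G : SimpleGraph (Fin (n + 1))) (F : Finset (Fin n × Fin n)) :
    Finset (Fin n → Fin n → ℤ) :=
  (finite_isSol G F).toFinset

/-- The first column `(a_{n,1}, …, a_{n,n})` of a triangular array. -/
def firstColumn {n : ℕ} (a : Fin n → Fin n → ℤ) : Fin n → ℤ :=
  fun j => a ⟨n - 1, Nat.sub_one_lt_of_lt j.2⟩ j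

/-- The multiset `LD(G,F)` of left-degree sequences: the first columns of the arrays in `Sol_G(F)`. -/
def LD {n : ℕ} (G : SimpleGraph (Fin (n + 1))) (F : Finset (Fin n × Fin n)) :
    Multiset (Fin n → ℤ) :=
  (sol G F).val.map firstColumn

/-- `codim(α) = #E(G) - (α_1 + ⋯ + α_n)`. -/
def codim {n : ℕ} (G : SimpleGraph (Fin (n + 1))) (α : Fin n → ℤ) : ℤ :=
  #(arcs G) - ∑ i, α i

/-- The polynomial `L_{G,F}(t)`, the sum of `(-1)^{codim(α)} t^α` over the multiset `LD(G,F)`. The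
entries of each `α` in `LD(G,F)` are nonnegative, so `Int.toNat` only changes their type. -/
def leftDegreePoly {n : ℕ} (G : SimpleGraph (Fin (n + 1))) (F : Finset (Fin n × Fin n)) :
    MvPolynomial (Fin n) ℤ :=
  ((LD G F).map fun α => MvPolynomial.monomial (Finsupp.equivFunOnFinite.symm fun i => (α i).toNat)
    ((codim G α).negOnePow : ℤ)).sum

/-- The point of `ℝ^n` given by an integer vector. -/
def toReal {n : ℕ} (α : Fin n → ℤ) : Fin n → ℝ := fun i => (α i : ℝ)

/-- The Newton polytope of a polynomial. -/
def newton {n : ℕ} (p : MvPolynomial (Fin n) ℤ) : Set (Fin n → ℝ) :=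
  convexHull ℝ ((fun (m : Fin n →₀ ℕ) (i : Fin n) => (m i : ℝ)) '' (p.support : Set (Fin n →₀ ℕ)))

/-- Each integer point of the Newton polytope of `p` is the exponent of a monomial of `p`. -/
def HasPolytopalSupport {n : ℕ} (p : MvPolynomial (Fin n) ℤ) : Prop :=
  ∀ α : Fin n → ℤ, toReal α ∈ newton p →
    ∃ m : Fin n →₀ ℕ, p.coeff m ≠ 0 ∧ ∀ i, (m i : ℤ) = α i

/-! ### Flows -/

/-- `f` is a flow with netflow vector `a` on the directed graph with edge set `E`; it is extended by
zero to the pairs that are not edges. -/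
structure IsFlow {V : Type*} [DecidableEq V] (E : Finset (V × V)) (a : V → ℝ) (f : V × V → ℝ) :
    Prop where
  nonneg : ∀ e ∈ E, 0 ≤ f e
  zero_ext : ∀ e, e ∉ E → f e = 0
  conservation : ∀ v, ∑ e ∈ E.filter (fun e => e.1 = v), f e - ∑ e ∈ E.filter (fun e => e.2 = v), f e
    = a v

/-- The edges of the graph on `[n] ∪ {t}` (where `t` is `none`) that consists of `G \ 0` and the edges
`(j,t)` for all `j` in `[n]`. -/
def extendedArcs {n : ℕ} (G : SimpleGraph (Fin (n + 1))) :
    Finset (Option (Fin n) × Option (Fin n)) :=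
  (arcsWithoutZero G).image (fun e => (some e.1, some e.2)) ∪ univ.image (fun j => (some j, none))

/-- The number `indeg_G(i) - outdeg_F(i)`. -/
def degDiff {n : ℕ} (G : SimpleGraph (Fin (n + 1))) (F : Finset (Fin n × Fin n)) (i : Fin n) : ℝ :=
  (indeg G i : ℝ) - outdeg F i

/-- The netflow vector `b_G^F`; its entry at `t` is `-#E(G \ F)`. -/
def netflow {n : ℕ} (G : SimpleGraph (Fin (n + 1))) (F : Finset (Fin n × Fin n)) :
    Option (Fin n) → ℝ
  | some i => degDiff G F i
  | none => -(#(arcs G \ F.image fun e => (e.1.succ, e.2.succ)) : ℝ)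

/-- The polytope of flows with netflow vector `b_G^F`. -/
def flows {n : ℕ} (G : SimpleGraph (Fin (n + 1))) (F : Finset (Fin n × Fin n)) :
    Set (Option (Fin n) × Option (Fin n) → ℝ) :=
  {f | IsFlow (extendedArcs G) (netflow G F) f}

/-- The values of `∑_{i ∈ I} f(i,t)` for the flows `f`. -/
def sinkValues {n : ℕ} (G : SimpleGraph (Fin (n + 1))) (F : Finset (Fin n × Fin n))
    (I : Finset (Fin n)) : Set ℝ :=
  (fun f => ∑ i ∈ I, f (some i, none)) '' flows G F

/-- The parameter `z_I^F`. -/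
def zParam {n : ℕ} (G : SimpleGraph (Fin (n + 1))) (F : Finset (Fin n × Fin n))
    (I : Finset (Fin n)) : ℝ :=
  sInf (sinkValues G F I)

/-! ### Generalized permutahedra -/

/-- The conditions on the parameters of a generalized permutahedron. -/
def IsGenPermParam {n : ℕ} (z : Finset (Fin n) → ℝ) : Prop :=
  z ∅ = 0 ∧ ∀ I J, z I + z J ≤ z (I ∪ J) + z (I ∩ J)

/-- The generalized permutahedron `P_n^z({z_I})`. -/
def genPermZ {n : ℕ} (z : Finset (Fin n) → ℝ) : Set (Fin n → ℝ) :=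
  {t | (∀ I, I ≠ univ → z I ≤ ∑ i ∈ I, t i) ∧ ∑ i, t i = z univ}

/-- The face `Δ_I` of the standard simplex, with `Δ_∅ = {0}`. -/
def simplexFace {n : ℕ} (I : Finset (Fin n)) : Set (Fin n → ℝ) :=
  if I = ∅ then {0} else convexHull ℝ ((fun i => Pi.single i (1 : ℝ)) '' (I : Set (Fin n)))

/-- The Minkowski sum `P_n^y({y_I})`, for nonnegative `y_I`. -/
def genPermY {n : ℕ} (y : Finset (Fin n) → ℝ) : Set (Fin n → ℝ) :=
  ∑ I : Finset (Fin n), y I • simplexFace I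

/-- The number of edges from vertices in `J` to vertices not in `J`. -/
def outdegSet {n : ℕ} (G : SimpleGraph (Fin (n + 1))) (J : Finset (Fin n)) : ℕ :=
  #((arcsWithoutZero G).filter fun e => e.1 ∈ J ∧ e.2 ∉ J)

theorem outdegSet_eq_zero {n : ℕ} (G : SimpleGraph (Fin (n + 1))) (J : Finset (Fin n)) :
    outdegSet G J = 0 ↔ ∀ e ∈ arcsWithoutZero G, e.1 ∈ J → e.2 ∈ J := by
  simp [outdegSet, filter_eq_empty_iff]

/-- The lattice of all `J ⊆ [n]` with outdegree `0`, ordered by inclusion. -/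
def closedSets {n : ℕ} (G : SimpleGraph (Fin (n + 1))) : Sublattice (Finset (Fin n)) where
  carrier := {J | outdegSet G J = 0}
  supClosed' := by
    intro A hA B hB
    simp only [Set.mem_ofPred_eq, outdegSet_eq_zero, sup_eq_union, mem_union] at *
    exact fun e he h => h.imp (hA e he) (hB e he)
  infClosed' := by
    intro A hA B hB
    simp only [Set.mem_ofPred_eq, outdegSet_eq_zero, inf_eq_inter, mem_inter] at *
    exact fun e he h => ⟨hA e he h.1, hB e he h.2⟩

open Classical in
/-- The parameter `y_J^F`: it is `indeg_G(k) - outdeg_F(k)` if `J` is a join-irreducible element of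
the lattice, `J` covers `J'` and `J \ J' = {k}` (as `J` covers only one element, at most one summand is
nonzero), and `0` if `J` is not a join-irreducible element. -/
def yParam {n : ℕ} (G : SimpleGraph (Fin (n + 1))) (F : Finset (Fin n × Fin n))
    (J : Finset (Fin n)) : ℝ :=
  ∑ k, if ∃ A A' : closedSets G, (A : Finset (Fin n)) = J ∧ SupIrred A ∧ A' ⋖ A ∧
    (A : Finset (Fin n)) \ (A' : Finset (Fin n)) = {k} then degDiff G F k else 0

open Classical in
/-- `δ(i)`: the vertices that can be reached from `i` by an increasing path, including `i`. -/
def reachable {n : ℕ} (G : SimpleGraph (Fin (n + 1))) (i : Fin n) : Finset (Fin n) :=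
  univ.filter fun k => Relation.ReflTransGen (fun u v => (u, v) ∈ arcsWithoutZero G) i k

/-- The Minkowski sum of the simplices `(indeg_G(i) - outdeg_F(i)) Δ_{δ(i)}` over `i` in `[n]`. -/
def minkowskiSum {n : ℕ} (G : SimpleGraph (Fin (n + 1))) (F : Finset (Fin n × Fin n)) :
    Set (Fin n → ℝ) :=
  ∑ i : Fin n, degDiff G F i • simplexFace (reachable G i)

end

end LeftDegree

open LeftDegree

namespace LeftDegree

open Finset
open scoped Pointwise

/-! Everything reduces to one system of cut inequalities (`DominatesCuts`): `x ≥ 0`, total `∑ b`,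
and `x(J) ≥ b(J)` for each `J` that no arc leaves.

Down column `j` of a triangular array, the shifted entry drops only at arcs `(j,i)`. The drops form
an integral flow, and the first column `α` records what each vertex sends to the sink. The
Gale–Hoffman feasibility theorem (`exists_excess_eq`) holds over any ordered commutative ring. Over
`ℤ` it describes `LD(G,F)` (`mem_LD_iff`), over `ℝ` the sink values of flows (`image_flows`), by the
same inequalities.

The largest `b(J)` over out-closed `J ⊆ I` is supermodular in `I`, since out-closed sets are stable
under union and intersection. If it equals `∑ b` at `I = [n]`, which is equivalent to the existence
of a flow, the cut system is the generalized permutahedron of `cutBound`. The greedy algorithm gives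
an integral minimizer of each linear functional, so the polytope is the hull of its integer points,
and indicator functionals identify `cutBound` with the minima `z_I`. Coefficients do not cancel
because the sign depends only on the exponent.

For `b ≥ 0`, a functional is minimized by moving each supply `b_i` to the cheapest vertex of `δ(i)`;
this gives the Minkowski sum. The sets `δ(i)` are exactly the join-irreducible closed sets. -/

/-! ### Feasibility of transshipment problems -/

/-- Outflow minus inflow of `g` at the vertex `v` of the directed graph with edge set `E`. -/
def excess {V R : Type*} [DecidableEq V] [AddCommGroup R] (E : Finset (V × V)) (g : V × V → R)
    (v : V) : R :=
  ∑ e ∈ E.filter (fun e => e.1 = v), g e - ∑ e ∈ E.filter (fun e => e.2 = v), g e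

/-- No edge in `E` leaves the vertex set `J`. -/
def OutClosed {V : Type*} (E : Finset (V × V)) (J : Finset V) : Prop :=
  ∀ e ∈ E, e.1 ∈ J → e.2 ∈ J

theorem OutClosed.union {V : Type*} [DecidableEq V] {E : Finset (V × V)} {J K : Finset V}
    (hJ : OutClosed E J) (hK : OutClosed E K) : OutClosed E (J ∪ K) := by
  intro e he h
  rw [mem_union] at h ⊢
  exact h.imp (hJ e he) (hK e he)

theorem OutClosed.inter {V : Type*} [DecidableEq V] {E : Finset (V × V)} {J K : Finset V}
    (hJ : OutClosed E J) (hK : OutClosed E K) : OutClosed E (J ∩ K) := by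
  intro e he h
  rw [mem_inter] at h ⊢
  exact ⟨hJ e he h.1, hK e he h.2⟩

section

variable {V R : Type*} [Fintype V] [DecidableEq V] [CommRing R]

/-- Summation by parts. Indicator potentials give cut identities; a cost potential later gives weak
duality. -/
theorem sum_mul_excess (E : Finset (V × V)) (g : V × V → R) (μ : V → R) :
    ∑ v, μ v * excess E g v = ∑ e ∈ E, g e * (μ e.1 - μ e.2) := by
  simp only [excess, mul_sub, sum_sub_distrib, sum_filter, mul_sum, mul_ite, mul_zero]
  rw [sum_comm, sum_comm (s := univ) (t := E)]
  simp [mul_comm]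

theorem sum_excess_le_zero [LinearOrder R] [IsStrictOrderedRing R] {E : Finset (V × V)}
    {g : V × V → R} (hg : ∀ e ∈ E, 0 ≤ g e) {J : Finset V} (hJ : OutClosed E J) :
    ∑ v ∈ J, excess E g v ≤ 0 := by
  have h := sum_mul_excess E g (fun v => if v ∈ J then 1 else 0)
  simp only [ite_mul, one_mul, zero_mul, sum_ite_mem, univ_inter] at h
  rw [h]
  refine sum_nonpos fun e he => ?_
  have := hg e he
  have h1 := hJ e he
  by_cases h2 : e.1 ∈ J
  · simp [h2, h1 h2]
  · by_cases h3 : e.2 ∈ J <;> simp [h2, h3, this]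

theorem sum_excess (E : Finset (V × V)) (g : V × V → R) : ∑ v, excess E g v = 0 := by
  have h := sum_mul_excess E g (fun _ => 1)
  simpa using h

/-- Induction on the edges: fix a value `s` on one edge `(u,v)` so that the cut conditions survive
its deletion. Only sums and maxima of values of `d` occur, hence integral data give an integral `g`.
-/
theorem exists_excess_eq [LinearOrder R] [IsStrictOrderedRing R] (E : Finset (V × V)) :
    ∀ d : V → R, ∑ v, d v = 0 → (∀ J, OutClosed E J → ∑ v ∈ J, d v ≤ 0) →
      ∃ g : V × V → R, (∀ e, 0 ≤ g e) ∧ ∀ v, excess E g v = d v := by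
  classical
  induction E using Finset.induction_on with
  | empty =>
    intro d h0 h
    refine ⟨0, fun _ => le_rfl, fun v => ?_⟩
    have h1 : ∀ v ∈ univ, d v ≤ 0 := fun v _ => by
      simpa using h {v} (fun e he => by simp at he)
    have h2 := (sum_eq_zero_iff_of_nonpos h1).1 h0 v (mem_univ v)
    simp [excess, h2]
  | insert p E hp ih =>
    intro d h0 h
    obtain ⟨u, v⟩ := p
    have hclosed : ∀ J : Finset V, OutClosed E J → (u ∈ J → v ∈ J) →
        OutClosed (insert (u, v) E) J := by
      intro J hJ huv e he h
      rcases mem_insert.1 he with rfl | he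
      · exact huv h
      · exact hJ e he h
    let C := (univ : Finset (Finset V)).filter fun J => OutClosed E J ∧ u ∈ J ∧ v ∉ J
    -- The sets in `C` become out-closed only once `(u,v)` is deleted; `s` is the least nonnegative
    -- value that meets their new conditions.
    obtain ⟨s, hs0, hsC, hsm⟩ : ∃ s : R, 0 ≤ s ∧ (∀ J ∈ C, ∑ i ∈ J, d i ≤ s) ∧
        (s = 0 ∨ ∃ J ∈ C, s = ∑ i ∈ J, d i) := by
      rcases C.eq_empty_or_nonempty with hC | hC
      · exact ⟨0, le_rfl, by simp [hC], Or.inl rfl⟩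
      · obtain ⟨J, hJ, hm⟩ := C.exists_max_image (fun J => ∑ i ∈ J, d i) hC
        rcases le_total (∑ i ∈ J, d i) 0 with h1 | h1
        · exact ⟨0, le_rfl, fun K hK => (hm K hK).trans h1, Or.inl rfl⟩
        · exact ⟨_, h1, hm, Or.inr ⟨J, hJ, rfl⟩⟩
    -- Uncrossing: if `J` attains `s`, then `K ∪ J` contains both endpoints and `K ∩ J` neither, so
    -- both are out-closed in the full graph.
    have hsK : ∀ K : Finset V, OutClosed E K → v ∈ K → u ∉ K → ∑ i ∈ K, d i + s ≤ 0 := by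
      intro K hK hv hu
      rcases hsm with rfl | ⟨J, hJ, rfl⟩
      · simpa using h K (hclosed K hK fun hu' => absurd hu' hu)
      · obtain ⟨hJ, huJ, hvJ⟩ := (mem_filter.1 hJ).2
        have h1 := h (K ∪ J) (hclosed _ (hK.union hJ) fun _ => mem_union_left _ hv)
        have h2 := h (K ∩ J) (hclosed _ (hK.inter hJ) fun hu' => absurd (mem_inter.1 hu').1 hu)
        have h3 := sum_union_inter (s₁ := K) (s₂ := J) (f := d)
        linarith
    obtain ⟨g, hg0, hg⟩ := ih
      (fun i => d i - (if i = u then s else 0) + (if i = v then s else 0))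
      (by simp [sum_add_distrib, h0]) (by
        intro J hJ
        simp only [sum_add_distrib, sum_sub_distrib, sum_ite_eq']
        by_cases huJ : u ∈ J <;> by_cases hvJ : v ∈ J
        · simpa [huJ, hvJ] using h J (hclosed J hJ fun _ => hvJ)
        · have := hsC J (mem_filter.2 ⟨mem_univ _, hJ, huJ, hvJ⟩)
          simpa [huJ, hvJ] using this
        · simpa [huJ, hvJ] using hsK J hJ hvJ huJ
        · simpa [huJ, hvJ] using h J (hclosed J hJ fun hu => absurd hu huJ))
    refine ⟨Function.update g (u, v) s, fun e => ?_, fun i => ?_⟩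
    · rcases eq_or_ne e (u, v) with rfl | he
      · simpa using hs0
      · simpa [he] using hg0 e
    · have h1 : ∀ e ∈ E, Function.update g (u, v) s e = g e := fun e he =>
        Function.update_of_ne (ne_of_mem_of_not_mem he hp) _ _
      have h2 := hg i
      have h3 : ∀ P : V × V → Prop, ∀ _ : DecidablePred P,
          ∑ e ∈ (insert (u, v) E).filter P, Function.update g (u, v) s e =
          (if P (u, v) then s else 0) + ∑ e ∈ E.filter P, g e := by
        intro P _
        rw [sum_filter, sum_insert hp, sum_filter]
        congr 1
        · simp
        · exact sum_congr rfl fun e he => by rw [h1 e he]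
      simp only [excess] at h2 ⊢
      rw [h3, h3]
      simp only [eq_comm (a := i)] at h2
      simp only
      linear_combination h2

end

/-! ### The greedy algorithm for supermodular functions -/

section

variable {V K : Type*} [DecidableEq V] [LinearOrder K]

/-- Take the increments of `w` along the chain of initial segments of `κ`. They telescope on initial
segments, and supermodularity bounds `w` on other sets as the `κ`-largest element is added. -/
theorem exists_greedy [Fintype V] (w : Finset V → ℤ) (h0 : w ∅ = 0)
    (hw : ∀ I J, w I + w J ≤ w (I ∪ J) + w (I ∩ J)) (κ : V → K) (hκ : Function.Injective κ) :
    ∃ y : V → ℤ, (∀ I, w I ≤ ∑ i ∈ I, y i) ∧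
      ∀ I : Finset V, (∀ i ∈ I, ∀ j, κ j < κ i → j ∈ I) → ∑ i ∈ I, y i = w I := by
  let B : V → Finset V := fun i => univ.filter fun j => κ j < κ i
  have hB : ∀ i, i ∉ B i := by simp [B]
  refine ⟨fun i => w (insert i (B i)) - w (B i), fun I => ?_, fun I => ?_⟩
  · induction I using Finset.induction_on_max_value κ with
    | empty => simp [h0]
    | insert a s has hmax ih =>
      have hs : s ⊆ B a := fun x hx => by
        simp only [B, mem_filter, mem_univ, true_and]
        exact lt_of_le_of_ne (hmax x hx) fun h => has (hκ h ▸ hx)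
      have h1 := hw (insert a s) (B a)
      have h2 : insert a s ∪ B a = insert a (B a) := by
        rw [insert_union, union_eq_right.2 hs]
      have h3 : insert a s ∩ B a = s := by
        rw [insert_inter_of_notMem (hB a), inter_eq_left.2 hs]
      rw [h2, h3] at h1
      rw [sum_insert has]
      linarith
  · induction I using Finset.induction_on_max_value κ with
    | empty => simp [h0]
    | insert a s has hmax ih =>
      intro hlow
      have hs : s = B a := by
        ext x
        simp only [B, mem_filter, mem_univ, true_and]
        refine ⟨fun hx => lt_of_le_of_ne (hmax x hx) fun h => has (hκ h ▸ hx), fun hx => ?_⟩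
        rcases mem_insert.1 (hlow a (mem_insert_self a s) x hx) with rfl | h
        · exact absurd hx (lt_irrefl _)
        · exact h
      have h1 := ih fun i hi j hj => by
        rcases mem_insert.1 (hlow i (mem_insert_of_mem hi) j hj) with rfl | h
        · exact absurd (hj.trans_le (hmax i hi)) (lt_irrefl _)
        · exact h
      rw [sum_insert has, h1, ← hs]
      ring

/-- Abel summation: `c` does not increase along `κ` and the sums of `δ` over initial segments are
nonnegative. The bound `γ` carries the induction; for total sum zero the left side vanishes. -/
theorem mul_sum_le_sum_mul (κ : V → K) (c δ : V → ℝ) (hc : ∀ i j, κ i ≤ κ j → c j ≤ c i)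
    (hδ : ∀ I : Finset V, 0 ≤ ∑ i ∈ I, δ i ∨ ∃ i ∈ I, ∃ j, κ j < κ i ∧ j ∉ I) (I : Finset V) :
    (∀ i ∈ I, ∀ j, κ j < κ i → j ∈ I) → ∀ γ : ℝ, (∀ i ∈ I, γ ≤ c i) →
      γ * ∑ i ∈ I, δ i ≤ ∑ i ∈ I, c i * δ i := by
  induction I using Finset.induction_on_max_value κ with
  | empty => simp
  | insert a s has hmax ih =>
    intro hlow γ hγ
    have h1 := ih (fun i hi j hj => by
      rcases mem_insert.1 (hlow i (mem_insert_of_mem hi) j hj) with rfl | h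
      · exact absurd (hj.trans_le (hmax i hi)) (lt_irrefl _)
      · exact h) (c a) fun i hi => hc i a (hmax i hi)
    have h2 : 0 ≤ ∑ i ∈ insert a s, δ i := by
      rcases hδ (insert a s) with h | ⟨i, hi, j, hj, hn⟩
      · exact h
      · exact absurd (hlow i hi j hj) hn
    have h3 := mul_le_mul_of_nonneg_right (hγ a (mem_insert_self a s)) h2
    rw [sum_insert has] at h3 ⊢
    rw [sum_insert has]
    linarith

end

/-- A base of an integral supermodular function that minimizes a linear functional. -/
theorem exists_base_minimizing {n : ℕ} (w : Finset (Fin n) → ℤ) (h0 : w ∅ = 0)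
    (hw : ∀ I J, w I + w J ≤ w (I ∪ J) + w (I ∩ J)) (c : Fin n → ℝ) :
    ∃ y : Fin n → ℤ, toReal y ∈ genPermZ (fun I => (w I : ℝ)) ∧
      (∀ t : ℝ, ∑ i ∈ univ.filter (fun i => t < c i), y i = w (univ.filter fun i => t < c i)) ∧
      ∀ x ∈ genPermZ (fun I => (w I : ℝ)), ∑ i, c i * y i ≤ ∑ i, c i * x i := by
  -- Decreasing cost makes superlevel sets of `c` initial segments; the index breaks ties.
  let κ : Fin n → ℝ ×ₗ Fin n := fun i => toLex (-c i, i)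
  have hκ : Function.Injective κ := fun i j h => by
    have := congrArg (fun p => (ofLex p).2) h
    exact this
  have hc : ∀ i j, κ i ≤ κ j → c j ≤ c i := by
    intro i j h
    rcases (Prod.Lex.toLex_le_toLex.1 h) with h | h
    · simp only at h; linarith
    · have := h.1; simp only at this; linarith
  obtain ⟨y, hy, hy'⟩ := exists_greedy w h0 hw κ hκ
  have huniv : ∑ i, y i = w univ := hy' univ fun _ _ _ _ => mem_univ _
  refine ⟨y, ⟨fun I _ => ?_, ?_⟩, fun t => hy' _ ?_, fun x hx => ?_⟩
  · simp only [toReal]; exact_mod_cast hy I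
  · simp only [toReal]; exact_mod_cast huniv
  · intro i hi j hj
    simp only [mem_filter, mem_univ, true_and] at hi ⊢
    exact hi.trans_le (hc j i hj.le)
  · have hxu : ∑ i, (x i - y i) = 0 := by
      rw [sum_sub_distrib, hx.2]; simp only [← huniv]; push_cast; ring
    obtain ⟨γ, hγ⟩ : ∃ γ : ℝ, ∀ i, γ ≤ c i := by
      obtain ⟨γ, hγ⟩ := (Set.finite_range c).bddBelow
      exact ⟨γ, fun i => hγ ⟨i, rfl⟩⟩
    have h := mul_sum_le_sum_mul κ c (fun i => x i - y i) hc (fun I => by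
      by_cases hI : ∀ i ∈ I, ∀ j, κ j < κ i → j ∈ I
      · left
        rcases eq_or_ne I univ with rfl | hne
        · exact hxu.ge
        · have h1 := hx.1 I hne
          have h2 : (∑ i ∈ I, (y i : ℝ)) = w I := by exact_mod_cast hy' I hI
          rw [sum_sub_distrib, h2]
          simp only at h1
          linarith
      · right
        push Not at hI
        exact hI) univ (fun _ _ _ _ => mem_univ _) γ fun i _ => hγ i
    rw [hxu, mul_zero] at h
    simp only [mul_sub, sum_sub_distrib] at h
    linarith

/-- A set is contained in the convex hull of a finite set in which each linear functional has a point
where it is at most its infimum on the given set. -/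
theorem subset_convexHull_of_forall_exists_le {n : ℕ} {T P : Set (Fin n → ℝ)} (hT : T.Finite)
    (h : ∀ c : Fin n → ℝ, ∃ t ∈ T, ∀ x ∈ P, ∑ i, c i * t i ≤ ∑ i, c i * x i) :
    P ⊆ convexHull ℝ T := by
  intro x hx
  by_contra hxT
  obtain ⟨f, u, h1, h2⟩ := geometric_hahn_banach_closed_point (convex_convexHull ℝ T)
    (hT.isClosed_convexHull (𝕜 := ℝ)) hxT
  -- The separating functional is larger at `x` than on the hull, so its negative is the cost to
  -- minimize.
  obtain ⟨t, ht, hle⟩ := h fun i => -f (Pi.single i 1)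
  have hf : ∀ y : Fin n → ℝ, ∑ i, -f (Pi.single i 1) * y i = -f y := by
    intro y
    have := LinearMap.pi_apply_eq_sum_univ (f : (Fin n → ℝ) →ₗ[ℝ] ℝ) y
    simp only [ContinuousLinearMap.coe_coe, smul_eq_mul] at this
    rw [this, ← sum_neg_distrib]
    refine sum_congr rfl fun i _ => ?_
    have : (fun j => if i = j then (1 : ℝ) else 0) = Pi.single i 1 := by
      ext j; simp [Pi.single_apply, eq_comm]
    rw [this]; ring
  have h3 := hle x hx
  rw [hf, hf] at h3
  have h4 := h1 t (subset_convexHull ℝ T ht)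
  linarith

/-! ### The supermodular function of cut bounds -/

section

variable {V : Type*}

open Classical in
/-- The largest total supply of an out-closed set contained in `I`. -/
noncomputable def cutBound (E : Finset (V × V)) (b : V → ℤ) (I : Finset V) : ℤ :=
  (I.powerset.filter (OutClosed E)).sup'
    ⟨∅, mem_filter.2 ⟨empty_mem_powerset I, fun _ _ h => absurd h (notMem_empty _)⟩⟩
    fun J => ∑ v ∈ J, b v

theorem le_cutBound {E : Finset (V × V)} (b : V → ℤ) {I J : Finset V} (hJ : OutClosed E J)
    (hJI : J ⊆ I) : ∑ v ∈ J, b v ≤ cutBound E b I := by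
  classical
  exact le_sup' (fun J => ∑ v ∈ J, b v) (mem_filter.2 ⟨mem_powerset.2 hJI, hJ⟩)

theorem exists_cutBound_eq (E : Finset (V × V)) (b : V → ℤ) (I : Finset V) :
    ∃ J, OutClosed E J ∧ J ⊆ I ∧ cutBound E b I = ∑ v ∈ J, b v := by
  classical
  obtain ⟨J, hJ, h⟩ := exists_mem_eq_sup' (s := I.powerset.filter (OutClosed E))
    ⟨∅, mem_filter.2 ⟨empty_mem_powerset I, fun _ _ h => absurd h (notMem_empty _)⟩⟩
    (fun J => ∑ v ∈ J, b v)
  exact ⟨J, (mem_filter.1 hJ).2, mem_powerset.1 (mem_filter.1 hJ).1, h⟩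

theorem cutBound_empty (E : Finset (V × V)) (b : V → ℤ) : cutBound E b ∅ = 0 := by
  obtain ⟨J, _, hJ, h⟩ := exists_cutBound_eq E b ∅
  rw [h, subset_empty.1 hJ, sum_empty]

theorem outClosed_univ [Fintype V] (E : Finset (V × V)) : OutClosed E univ := fun _ _ _ => mem_univ _

/-- The union and intersection of maximizers for `I` and `J` are candidates for `I ∪ J` and `I ∩ J`.
-/
theorem cutBound_supermodular [DecidableEq V] (E : Finset (V × V)) (b : V → ℤ) (I J : Finset V) :
    cutBound E b I + cutBound E b J ≤ cutBound E b (I ∪ J) + cutBound E b (I ∩ J) := by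
  obtain ⟨A, hA, hAI, h1⟩ := exists_cutBound_eq E b I
  obtain ⟨B, hB, hBJ, h2⟩ := exists_cutBound_eq E b J
  rw [h1, h2, ← sum_union_inter]
  exact add_le_add (le_cutBound b (hA.union hB) (union_subset_union hAI hBJ))
    (le_cutBound b (hA.inter hB) (inter_subset_inter hAI hBJ))

/-- The points `x ≥ 0` with the total supply whose sum over each out-closed set is at least the supply
of the set. -/
def DominatesCuts [Fintype V] {R : Type*} [CommRing R] [LinearOrder R] (E : Finset (V × V)) (b x : V → R) :
    Prop :=
  (∀ v, 0 ≤ x v) ∧ (∀ J, OutClosed E J → ∑ v ∈ J, b v ≤ ∑ v ∈ J, x v) ∧ ∑ v, x v = ∑ v, b v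

/-- Feasibility for the supply `b - x` that remains after `x` has left for the sink. -/
theorem dominatesCuts_iff [Fintype V] [DecidableEq V] {R : Type*} [CommRing R] [LinearOrder R] [IsStrictOrderedRing R]
    {E : Finset (V × V)} {b x : V → R} :
    DominatesCuts E b x ↔ (∀ v, 0 ≤ x v) ∧
      ∃ g : V × V → R, (∀ e ∈ E, 0 ≤ g e) ∧ ∀ v, excess E g v = b v - x v := by
  refine and_congr_right fun _ => ⟨fun ⟨h, h0⟩ => ?_, fun ⟨g, hg, h⟩ => ⟨fun J hJ => ?_, ?_⟩⟩
  · obtain ⟨g, hg, h'⟩ := exists_excess_eq E (fun v => b v - x v)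
      (by rw [sum_sub_distrib, h0, sub_self])
      (fun J hJ => by rw [sum_sub_distrib]; exact sub_nonpos.2 (h J hJ))
    exact ⟨g, fun e _ => hg e, h'⟩
  · have := sum_excess_le_zero hg hJ
    simp only [h, sum_sub_distrib] at this
    exact sub_nonpos.1 this
  · have := sum_excess E g
    simp only [h, sum_sub_distrib] at this
    exact (sub_eq_zero.1 this).symm

theorem dominatesCuts_intCast [Fintype V] {R : Type*} [CommRing R] [LinearOrder R] [IsStrictOrderedRing R]
    {E : Finset (V × V)} {b x : V → ℤ} :
    DominatesCuts E (fun v => (b v : R)) (fun v => (x v : R)) ↔ DominatesCuts E b x := by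
  simp only [DominatesCuts]
  norm_cast

/-- For out-closed `J`, `b(J) ≤ x(J) ≤ x(V) = b(V)`. The resulting equality serves as the integral
criterion for the existence of a flow. -/
theorem DominatesCuts.cutBound_univ [Fintype V] {R : Type*} [CommRing R] [LinearOrder R]
    [IsStrictOrderedRing R] {E : Finset (V × V)} {b : V → ℤ} {x : V → R}
    (h : DominatesCuts E (fun v => (b v : R)) x) : cutBound E b univ = ∑ v, b v := by
  refine le_antisymm ?_ (le_cutBound b (outClosed_univ E) (subset_univ _))
  obtain ⟨J, hJ, _, h1⟩ := exists_cutBound_eq E b univ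
  have h2 := (h.2.1 J hJ).trans (sum_le_sum_of_subset_of_nonneg (subset_univ J)
    fun v _ _ => h.1 v)
  rw [h.2.2] at h2
  rw [h1]
  simp only at h2
  exact_mod_cast h2

end

/-- Nonnegativity is the singleton constraint with candidate `∅`. Conversely, `x(I) ≥ x(J) ≥ b(J)`
for the maximizing `J ⊆ I`. -/
theorem mem_genPermZ_cutBound {n : ℕ} {E : Finset (Fin n × Fin n)} {b : Fin n → ℤ}
    (h : cutBound E b univ = ∑ v, b v) {x : Fin n → ℝ} :
    x ∈ genPermZ (fun I => (cutBound E b I : ℝ)) ↔ DominatesCuts E (fun v => (b v : ℝ)) x := by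
  constructor
  · rintro ⟨h1, h2⟩
    have h3 : ∀ I, (cutBound E b I : ℝ) ≤ ∑ i ∈ I, x i := fun I => by
      rcases eq_or_ne I univ with rfl | hI
      · exact h2.ge
      · exact h1 I hI
    refine ⟨fun i => ?_, fun J hJ => ?_, ?_⟩
    · have h4 : ∑ v ∈ ∅, b v ≤ cutBound E b {i} :=
        le_cutBound b (fun _ _ h => absurd h (notMem_empty _)) (empty_subset _)
      have h5 := h3 {i}
      rw [sum_singleton] at h5
      refine le_trans ?_ h5
      exact_mod_cast h4
    · refine le_trans ?_ (h3 J)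
      simp only
      exact_mod_cast le_cutBound b hJ subset_rfl
    · rw [h2]
      simp only [h]
      push_cast
      rfl
  · rintro ⟨h1, h2, h3⟩
    refine ⟨fun I _ => ?_, ?_⟩
    · obtain ⟨J, hJ, hJI, h4⟩ := exists_cutBound_eq E b I
      simp only [h4]
      push_cast
      exact (h2 J hJ).trans (sum_le_sum_of_subset_of_nonneg hJI fun v _ _ => h1 v)
    · rw [h3]
      simp only [h]
      push_cast
      rfl

/-! ### Counting edges -/

section

variable {n : ℕ} (G : SimpleGraph (Fin (n + 1))) (F : Finset (Fin n × Fin n))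

theorem mem_arcs {G : SimpleGraph (Fin (n + 1))} {e : Fin (n + 1) × Fin (n + 1)} :
    e ∈ arcs G ↔ e.1 < e.2 ∧ G.Adj e.1 e.2 := by
  simp [arcs]

theorem mem_arcsWithoutZero {G : SimpleGraph (Fin (n + 1))} {e : Fin n × Fin n} :
    e ∈ arcsWithoutZero G ↔ e.1 < e.2 ∧ G.Adj e.1.succ e.2.succ := by
  simp [arcsWithoutZero]

/-- The integer `indeg_G(i) - outdeg_F(i)`. -/
noncomputable def intDegDiff (i : Fin n) : ℤ := (indeg G i : ℤ) - outdeg F i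

theorem intCast_intDegDiff (i : Fin n) : (intDegDiff G F i : ℝ) = degDiff G F i := by
  simp [intDegDiff, degDiff]

theorem numArcsUpTo_eq_sum (i : Fin n) :
    numArcsUpTo G i = ∑ k ∈ univ.filter (· ≤ i), indeg G k := by
  simp only [numArcsUpTo, indeg, card_filter]
  rw [sum_comm]
  refine sum_congr rfl fun e he => ?_
  have h0 : e.2 ≠ 0 := fun h => by
    have := (mem_arcs.1 he).1
    rw [h] at this
    exact absurd this (Fin.not_lt_zero _)
  obtain ⟨k, hk⟩ := Fin.exists_succ_eq.2 h0
  rw [← hk]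
  simp [Fin.succ_le_succ_iff]

theorem card_arcs_eq_sum : #(arcs G) = ∑ k, indeg G k := by
  simp only [indeg, card_filter]
  rw [sum_comm, card_eq_sum_ones]
  refine sum_congr rfl fun e he => ?_
  have h0 : e.2 ≠ 0 := fun h => by
    have := (mem_arcs.1 he).1
    rw [h] at this
    exact absurd this (Fin.not_lt_zero _)
  obtain ⟨k, hk⟩ := Fin.exists_succ_eq.2 h0
  rw [← hk]
  simp

theorem card_eq_sum_outdeg : #F = ∑ k, outdeg F k := by
  simp only [outdeg, card_filter]
  rw [sum_comm, card_eq_sum_ones]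
  simp

/-- The netflow vector has sum zero; this yields conservation at the sink. -/
theorem card_arcs_sdiff (hF : F ⊆ arcsWithoutZero G) :
    (#(arcs G \ F.image fun e => (e.1.succ, e.2.succ)) : ℤ) = ∑ i, intDegDiff G F i := by
  have h1 : F.image (fun e => (e.1.succ, e.2.succ)) ⊆ arcs G := by
    intro e he
    obtain ⟨p, hp, rfl⟩ := mem_image.1 he
    have := mem_arcsWithoutZero.1 (hF hp)
    exact mem_arcs.2 ⟨Fin.succ_lt_succ_iff.2 this.1, this.2⟩
  have h2 : #(F.image fun e : Fin n × Fin n => (e.1.succ, e.2.succ)) = #F := by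
    refine card_image_of_injective F fun e e' h => ?_
    simp only [Prod.mk.injEq, Fin.succ_inj] at h
    exact Prod.ext h.1 h.2
  have h3 := card_sdiff_add_card_eq_card h1
  rw [h2, card_arcs_eq_sum, card_eq_sum_outdeg F] at h3
  simp only [intDegDiff, sum_sub_distrib]
  have h4 : (#(arcs G \ F.image fun e => (e.1.succ, e.2.succ)) : ℤ) + ∑ k, (outdeg F k : ℤ)
    = ∑ k, (indeg G k : ℤ) := by exact_mod_cast h3
  linarith

/-! ### Left-degree sequences and cuts -/

theorem mem_LD (α : Fin n → ℤ) : α ∈ LD G F ↔ ∃ a, IsSol G F a ∧ firstColumn a = α := by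
  simp [LD, sol]

theorem filter_le_eq_insert {i' i : Fin n} (h : (i' : ℕ) + 1 = i) :
    univ.filter (· ≤ i) = insert i (univ.filter (· ≤ i')) := by
  ext k
  simp only [mem_filter, mem_univ, true_and, mem_insert, Fin.le_def, Fin.ext_iff]
  omega

theorem filter_le_eq_insert_filter_lt (i : Fin n) :
    univ.filter (· ≤ i) = insert i (univ.filter (· < i)) := by
  ext k
  simp only [mem_filter, mem_univ, true_and, mem_insert]
  exact le_iff_eq_or_lt

variable {G F}

theorem IsSol.sum_row {a : Fin n → Fin n → ℤ} (h : IsSol G F a) (i : Fin n) :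
    ∑ k ∈ univ.filter (· ≤ i), (a i k + shift F i k) = ∑ k ∈ univ.filter (· ≤ i), (indeg G k : ℤ) := by
  rw [filter_le_eq_insert_filter_lt, sum_insert (by simp), h.diag, numArcsUpTo_eq_sum,
    filter_le_eq_insert_filter_lt]
  push_cast
  ring

/-- Induction on the row. By `IsSol.sum_row` the new diagonal entry collects `indeg i` and all drops
in the earlier columns. If `i ∈ J`, this outweighs the drops in the columns of `J`; if `i ∉ J`, no
arc leads from `J` to `i`, so those columns do not drop. -/
theorem IsSol.sum_indeg_le {a : Fin n → Fin n → ℤ} (h : IsSol G F a) {J : Finset (Fin n)}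
    (hJ : OutClosed (arcsWithoutZero G) J) (m : ℕ) : ∀ i : Fin n, (i : ℕ) = m →
    ∑ k ∈ univ.filter (· ≤ i), (if k ∈ J then (indeg G k : ℤ) else 0) ≤
      ∑ k ∈ univ.filter (· ≤ i), if k ∈ J then a i k + shift F i k else 0 := by
  induction m with
  | zero =>
    intro i hi
    have h1 : univ.filter (· ≤ i) = {i} := by
      ext k
      simp only [mem_filter, mem_univ, true_and, mem_singleton, Fin.le_def, Fin.ext_iff]
      omega
    have h2 := h.sum_row i
    rw [h1, sum_singleton, sum_singleton] at h2
    rw [h1, sum_singleton, sum_singleton, h2]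
  | succ m ih =>
    intro i hi
    have hm : m < n := by have := i.2; omega
    have hi' : ((⟨m, hm⟩ : Fin n) : ℕ) + 1 = i := hi.symm
    have ih' := ih ⟨m, hm⟩ rfl
    have hrow := h.sum_row i
    have hrow' := h.sum_row ⟨m, hm⟩
    generalize (⟨m, hm⟩ : Fin n) = i' at *
    have hni : i ∉ univ.filter (· ≤ i') := by
      simp only [mem_filter, mem_univ, true_and, Fin.le_def]
      omega
    rw [filter_le_eq_insert hi', sum_insert hni, sum_insert hni] at hrow ⊢
    have hanti : ∀ k ∈ univ.filter (· ≤ i'), a i k + shift F i k ≤ a i' k + shift F i' k :=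
      fun k hk => h.antitone k 1 i' i hi' (mem_filter.1 hk).2
    by_cases hiJ : i ∈ J
    · have h1 : ∑ k ∈ univ.filter (· ≤ i'),
          ((if k ∈ J then a i' k + shift F i' k else 0) - if k ∈ J then a i k + shift F i k else 0) ≤
          ∑ k ∈ univ.filter (· ≤ i'), ((a i' k + shift F i' k) - (a i k + shift F i k)) := by
        refine sum_le_sum fun k hk => ?_
        have := hanti k hk
        split_ifs <;> linarith
      rw [sum_sub_distrib, sum_sub_distrib] at h1
      simp only [hiJ, if_true]
      linarith
    · have h1 : ∑ k ∈ univ.filter (· ≤ i'), (if k ∈ J then a i k + shift F i k else 0) =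
          ∑ k ∈ univ.filter (· ≤ i'), if k ∈ J then a i' k + shift F i' k else 0 := by
        refine sum_congr rfl fun k hk => ?_
        split_ifs with hkJ
        · exact h.step_eq i' i k hi' (mem_filter.1 hk).2 fun he => hiJ (hJ _ he hkJ)
        · rfl
      simp only [hiJ, if_false, h1]
      linarith

theorem shift_last (hn : n - 1 < n) (j : Fin n) : shift F ⟨n - 1, hn⟩ j = outdeg F j := by
  simp only [shift, outdeg]
  congr 1
  refine filter_congr fun e _ => and_iff_left ?_
  rw [Fin.le_def]
  have := e.2.2
  simp only
  omega

theorem IsSol.dominatesCuts {a : Fin n → Fin n → ℤ} (h : IsSol G F a) :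
    DominatesCuts (arcsWithoutZero G) (intDegDiff G F) (firstColumn a) := by
  rcases Nat.eq_zero_or_pos n with rfl | hn
  · exact ⟨fun v => v.elim0, fun J _ => by simp [eq_empty_of_isEmpty], by simp⟩
  have hl : n - 1 < n := by omega
  have hu : univ.filter (· ≤ (⟨n - 1, hl⟩ : Fin n)) = univ := by
    ext k
    simp only [mem_filter, mem_univ, true_and, Fin.le_def, iff_true]
    have := k.2
    omega
  have hc : ∀ k, a ⟨n - 1, hl⟩ k = firstColumn a k := fun k => rfl
  refine ⟨fun v => h.nonneg _ _ ?_, fun J hJ => ?_, ?_⟩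
  · rw [Fin.le_def]
    have := v.2
    simp only
    omega
  · have h1 := h.sum_indeg_le hJ _ ⟨n - 1, hl⟩ rfl
    rw [hu, sum_ite_mem, sum_ite_mem, univ_inter] at h1
    simp only [shift_last, hc, sum_add_distrib] at h1
    simp only [intDegDiff, sum_sub_distrib]
    linarith
  · have h1 := h.sum_row ⟨n - 1, hl⟩
    rw [hu] at h1
    simp only [shift_last, hc, sum_add_distrib] at h1
    simp only [intDegDiff, sum_sub_distrib]
    linarith

/-- The triangular array of an integral flow `g` whose values at the edges to the sink are `α`. -/
noncomputable def flowArray (G : SimpleGraph (Fin (n + 1))) (F : Finset (Fin n × Fin n))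
    (α : Fin n → ℤ) (g : Fin n × Fin n → ℤ) (i j : Fin n) : ℤ :=
  if j ≤ i then α j + outdeg F j +
    ∑ e ∈ (arcsWithoutZero G).filter (fun e => e.1 = j ∧ i < e.2), g e - shift F i j else 0

theorem fst_lt_snd {e : Fin n × Fin n} (he : e ∈ arcsWithoutZero G) : e.1 < e.2 :=
  (mem_arcsWithoutZero.1 he).1

theorem flowArray_step (α : Fin n → ℤ) (g : Fin n × Fin n → ℤ) {i' i j : Fin n}
    (hi : (i' : ℕ) + 1 = i) (hj : j ≤ i') :
    flowArray G F α g i' j + shift F i' j = flowArray G F α g i j + shift F i j +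
      if (j, i) ∈ arcsWithoutZero G then g (j, i) else 0 := by
  have hj' : j ≤ i := by rw [Fin.le_def] at hj ⊢; omega
  have h1 : ∑ e ∈ (arcsWithoutZero G).filter (fun e => e.1 = j ∧ i' < e.2), g e =
      ∑ e ∈ (arcsWithoutZero G).filter (fun e => e.1 = j ∧ i < e.2), g e +
        if (j, i) ∈ arcsWithoutZero G then g (j, i) else 0 := by
    rw [← sum_ite_eq' (arcsWithoutZero G) (j, i) g, sum_filter, sum_filter, ← sum_add_distrib]
    refine sum_congr rfl fun e _ => ?_
    obtain ⟨u, v⟩ := e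
    simp only [Prod.mk.injEq]
    by_cases hu : u = j
    · have h2 : i' < v ↔ i < v ∨ v = i := by
        simp only [Fin.lt_def, Fin.ext_iff]
        omega
      by_cases hv : v = i
      · have h3 : i' < i := by rw [Fin.lt_def]; omega
        simp [hu, hv, h3]
      · simp [hu, h2, hv]
    · simp [hu]
  simp only [flowArray, hj, hj', if_true, h1]
  ring

theorem isSol_flowArray {α : Fin n → ℤ} {g : Fin n × Fin n → ℤ}
    (hα : ∀ i, 0 ≤ α i) (hg : ∀ e ∈ arcsWithoutZero G, 0 ≤ g e)
    (h : ∀ v, excess (arcsWithoutZero G) g v = intDegDiff G F v - α v) :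
    IsSol G F (flowArray G F α g) := by
  have hdiag : ∀ i, ∑ k ∈ univ.filter (· ≤ i), (flowArray G F α g i k + shift F i k) =
      ∑ k ∈ univ.filter (· ≤ i), (indeg G k : ℤ) := by
    intro i
    -- The total excess of the initial segment up to `i` is the flow crossing from it to later
    -- vertices, as arcs increase.
    have h1 := sum_mul_excess (arcsWithoutZero G) g (fun v => if v ≤ i then 1 else 0)
    have h2 : ∑ e ∈ arcsWithoutZero G,
        g e * ((if e.1 ≤ i then 1 else 0) - (if e.2 ≤ i then 1 else 0)) =
        ∑ k ∈ univ.filter (· ≤ i),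
          ∑ e ∈ (arcsWithoutZero G).filter (fun e => e.1 = k ∧ i < e.2), g e := by
      simp only [sum_filter (s := arcsWithoutZero G)]
      rw [sum_comm]
      refine sum_congr rfl fun e he => ?_
      have hlt := fst_lt_snd he
      by_cases h3 : e.2 ≤ i
      · simp [h3, hlt.le.trans h3, not_lt.2 h3]
      · have h4 : i < e.2 := not_le.1 h3
        simp [h3, h4]
    simp only [ite_mul, one_mul, zero_mul, ← sum_filter] at h1
    rw [h2] at h1
    simp only [h, intDegDiff, sum_sub_distrib] at h1
    have h3 : ∑ k ∈ univ.filter (· ≤ i), (flowArray G F α g i k + shift F i k) =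
        ∑ k ∈ univ.filter (· ≤ i), (α k + outdeg F k +
          ∑ e ∈ (arcsWithoutZero G).filter (fun e => e.1 = k ∧ i < e.2), g e) := by
      refine sum_congr rfl fun k hk => ?_
      simp only [flowArray, (mem_filter.1 hk).2, if_true]
      ring
    rw [h3, sum_add_distrib, sum_add_distrib]
    linarith
  refine ⟨fun i j hij => by simp [flowArray, not_le.2 hij], fun l j hl => ?_,
    fun i' i j hi hj he => ?_, fun i' i j hi hj he => ?_, fun i => ?_⟩
  · have hn : n - 1 < n := by omega
    have h1 : l = ⟨n - 1, hn⟩ := Fin.ext (by simp only; omega)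
    have h2 : j ≤ l := by rw [Fin.le_def]; have := j.2; omega
    have h3 : 0 ≤ ∑ e ∈ (arcsWithoutZero G).filter (fun e => e.1 = j ∧ l < e.2), g e :=
      sum_nonneg fun e he => hg e (mem_filter.1 he).1
    have h4 := hα j
    have h5 : shift F l j = outdeg F j := by rw [h1, shift_last]
    simp only [flowArray, h2, if_true, h5]
    linarith
  · have h1 := flowArray_step (G := G) (F := F) α g hi hj
    rw [if_pos he] at h1
    have := hg _ he
    linarith
  · have h1 := flowArray_step (G := G) (F := F) α g hi hj
    rw [if_neg he] at h1
    linarith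
  · have h1 := hdiag i
    rw [filter_le_eq_insert_filter_lt, sum_insert (by simp)] at h1
    rw [numArcsUpTo_eq_sum, filter_le_eq_insert_filter_lt]
    push_cast
    linarith

theorem firstColumn_flowArray (α : Fin n → ℤ) (g : Fin n × Fin n → ℤ) :
    firstColumn (flowArray G F α g) = α := by
  funext j
  have hn : n - 1 < n := Nat.sub_one_lt_of_lt j.2
  have h1 : j ≤ (⟨n - 1, hn⟩ : Fin n) := by rw [Fin.le_def]; have := j.2; simp only; omega
  have h2 : (arcsWithoutZero G).filter (fun e => e.1 = j ∧ (⟨n - 1, hn⟩ : Fin n) < e.2) = ∅ := by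
    refine filter_eq_empty_iff.2 fun e _ h => ?_
    have h3 := h.2
    rw [Fin.lt_def] at h3
    have := e.2.2
    simp only at h3
    omega
  simp only [firstColumn, flowArray, h1, if_true, h2, sum_empty, shift_last]
  ring

theorem mem_LD_iff (α : Fin n → ℤ) :
    α ∈ LD G F ↔ DominatesCuts (arcsWithoutZero G) (intDegDiff G F) α := by
  rw [mem_LD]
  constructor
  · rintro ⟨a, ha, rfl⟩
    exact ha.dominatesCuts
  · intro h
    obtain ⟨hα, g, hg, h'⟩ := dominatesCuts_iff.1 h
    exact ⟨_, isSol_flowArray hα hg h', firstColumn_flowArray α g⟩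

/-! ### Flows and cuts -/

theorem sum_filter_extendedArcs (f : Option (Fin n) × Option (Fin n) → ℝ)
    (P : Option (Fin n) × Option (Fin n) → Prop) [DecidablePred P] :
    ∑ e ∈ (extendedArcs G).filter P, f e =
      ∑ e ∈ (arcsWithoutZero G).filter (fun e => P (some e.1, some e.2)), f (some e.1, some e.2) +
      ∑ j, if P (some j, none) then f (some j, none) else 0 := by
  rw [sum_filter, extendedArcs, sum_union, sum_image, sum_image, sum_filter]
  · rintro ⟨a, b⟩ _ ⟨c, d⟩ _ h
    simpa using h
  · intro a _ b _ h
    simpa [Prod.ext_iff] using h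
  · rw [disjoint_left]
    intro e he he'
    obtain ⟨p, _, rfl⟩ := mem_image.1 he
    obtain ⟨q, _, hq⟩ := mem_image.1 he'
    simp at hq

theorem excess_extendedArcs_some (f : Option (Fin n) × Option (Fin n) → ℝ) (v : Fin n) :
    excess (extendedArcs G) f (some v) =
      excess (arcsWithoutZero G) (fun e => f (some e.1, some e.2)) v + f (some v, none) := by
  simp only [excess, sum_filter_extendedArcs]
  simp
  ring

theorem excess_extendedArcs_none (f : Option (Fin n) × Option (Fin n) → ℝ) :
    excess (extendedArcs G) f none = - ∑ i, f (some i, none) := by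
  simp only [excess, sum_filter_extendedArcs]
  simp

/-- Deleting the sink leaves a transshipment with supply `b - x`, where `x` lists the values on the
sink edges. -/
theorem image_flows (hF : F ⊆ arcsWithoutZero G) :
    (fun f i => f (some i, none)) '' flows G F =
      {x | DominatesCuts (arcsWithoutZero G) (fun v => (intDegDiff G F v : ℝ)) x} := by
  have hE : ∀ j : Fin n, (some j, none) ∈ extendedArcs G := fun j =>
    mem_union_right _ (mem_image.2 ⟨j, mem_univ _, rfl⟩)
  have hE' : ∀ u v : Fin n, (some u, some v) ∈ extendedArcs G ↔ (u, v) ∈ arcsWithoutZero G := by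
    intro u v
    simp [extendedArcs]
  have hE'' : ∀ v : Option (Fin n), (none, v) ∉ extendedArcs G := by
    intro v
    simp [extendedArcs]
  ext x
  rw [Set.mem_ofPred_eq, dominatesCuts_iff]
  constructor
  · rintro ⟨f, hf, rfl⟩
    refine ⟨fun v => hf.nonneg _ (hE v), fun e => f (some e.1, some e.2),
      fun e he => hf.nonneg _ ((hE' _ _).2 he), fun v => ?_⟩
    have h1 : excess (extendedArcs G) f (some v) = degDiff G F v := hf.conservation (some v)
    rw [excess_extendedArcs_some, ← intCast_intDegDiff] at h1
    linarith
  · intro h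
    have hsum := (dominatesCuts_iff.2 h).2.2
    obtain ⟨hx, g, hg, h⟩ := h
    let f : Option (Fin n) × Option (Fin n) → ℝ := fun e =>
      match e with
      | (some u, some v) => if (u, v) ∈ arcsWithoutZero G then g (u, v) else 0
      | (some u, none) => x u
      | (none, _) => 0
    refine ⟨f, ⟨?_, ?_, ?_⟩, rfl⟩
    · rintro ⟨_ | u, _ | v⟩ he
      · exact le_rfl
      · exact le_rfl
      · exact hx u
      · simp only [f, if_pos ((hE' u v).1 he)]
        exact hg _ ((hE' u v).1 he)
    · rintro ⟨_ | u, _ | v⟩ he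
      · rfl
      · rfl
      · exact absurd (hE u) he
      · simp only [f, if_neg (fun h => he ((hE' u v).2 h))]
    · rintro (_ | v)
      · refine (excess_extendedArcs_none f).trans ?_
        have h1 : (#(arcs G \ F.image fun e => (e.1.succ, e.2.succ)) : ℝ) =
            ∑ i, (intDegDiff G F i : ℝ) := by exact_mod_cast card_arcs_sdiff G F hF
        simp only [netflow, h1, ← hsum, f]
      · refine (excess_extendedArcs_some f v).trans ?_
        have h1 : excess (arcsWithoutZero G) (fun e => f (some e.1, some e.2)) v =
            excess (arcsWithoutZero G) g v := by
          simp only [excess]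
          congr 1 <;>
          · refine sum_congr rfl fun e he => ?_
            simp only [f, if_pos (mem_filter.1 he).1]
        rw [h1, h v, intCast_intDegDiff]
        simp [f, netflow]

end

section

variable {n : ℕ} {G : SimpleGraph (Fin (n + 1))} {F : Finset (Fin n × Fin n)}

/-! ### The Newton polytope of the left-degree polynomial -/

theorem coeff_leftDegreePoly_ne_zero (m : Fin n →₀ ℕ) :
    (leftDegreePoly G F).coeff m ≠ 0 ↔ (fun i => (m i : ℤ)) ∈ LD G F := by
  classical
  have h1 : leftDegreePoly G F = ∑ a ∈ sol G F, MvPolynomial.monomial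
      (Finsupp.equivFunOnFinite.symm fun i => (firstColumn a i).toNat)
      ((codim G (firstColumn a)).negOnePow : ℤ) := by
    rw [leftDegreePoly, LD, Multiset.map_map]
    rfl
  have h2 : ∀ a ∈ sol G F,
      (Finsupp.equivFunOnFinite.symm fun i => (firstColumn a i).toNat) = m ↔
        firstColumn a = fun i => (m i : ℤ) := by
    intro a ha
    have h : IsSol G F a := by simpa [sol] using ha
    have h0 := h.dominatesCuts.1
    simp only [DFunLike.ext_iff, funext_iff, Finsupp.equivFunOnFinite_symm_apply_apply]
    exact forall_congr' fun i => by have := h0 i; omega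
  have h3 : (leftDegreePoly G F).coeff m =
      #((sol G F).filter fun a => firstColumn a = fun i => (m i : ℤ)) *
        ((codim G fun i => (m i : ℤ)).negOnePow : ℤ) := by
    rw [h1, MvPolynomial.coeff_sum, card_filter, Nat.cast_sum, sum_mul]
    refine sum_congr rfl fun a ha => ?_
    rw [MvPolynomial.coeff_monomial]
    by_cases h : firstColumn a = fun i => (m i : ℤ)
    · rw [if_pos ((h2 a ha).2 h), if_pos h, h, Nat.cast_one, one_mul]
    · rw [if_neg fun h' => h ((h2 a ha).1 h'), if_neg h, Nat.cast_zero, zero_mul]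
  rw [h3, mul_ne_zero_iff, and_iff_left (Units.ne_zero _), Nat.cast_ne_zero, card_ne_zero]
  simp only [LD, Multiset.mem_map, Finset.Nonempty, mem_filter, mem_val]

theorem newton_leftDegreePoly :
    newton (leftDegreePoly G F) = convexHull ℝ (toReal '' {α | α ∈ LD G F}) := by
  rw [newton]
  congr 1
  ext x
  constructor
  · rintro ⟨m, hm, rfl⟩
    refine ⟨fun i => (m i : ℤ), ?_, ?_⟩
    · exact (coeff_leftDegreePoly_ne_zero m).1 (MvPolynomial.mem_support_iff.1 hm)
    · funext i
      simp [toReal]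
  · rintro ⟨α, hα, rfl⟩
    have h0 := ((mem_LD_iff α).1 hα).1
    have h1 : (fun i => (((Finsupp.equivFunOnFinite.symm fun i => (α i).toNat) : Fin n →₀ ℕ) i : ℤ))
        = α := by
      funext i
      simp [h0 i]
    refine ⟨Finsupp.equivFunOnFinite.symm fun i => (α i).toNat, ?_, ?_⟩
    · refine MvPolynomial.mem_support_iff.2 ((coeff_leftDegreePoly_ne_zero _).2 ?_)
      rw [h1]
      exact hα
    · funext i
      have := congrFun h1 i
      simp only [toReal]
      exact_mod_cast this

theorem convex_genPermZ (z : Finset (Fin n) → ℝ) : Convex ℝ (genPermZ z) := by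
  intro x hx y hy a b ha hb hab
  have h : ∀ I : Finset (Fin n), ∑ i ∈ I, (a • x + b • y) i = a * ∑ i ∈ I, x i + b * ∑ i ∈ I, y i :=
    fun I => by simp [sum_add_distrib, mul_sum]
  refine ⟨fun I hI => ?_, ?_⟩
  · rw [h]
    have h1 := mul_le_mul_of_nonneg_left (hx.1 I hI) ha
    have h2 := mul_le_mul_of_nonneg_left (hy.1 I hI) hb
    calc z I = a * z I + b * z I := by rw [← add_mul, hab, one_mul]
      _ ≤ _ := add_le_add h1 h2
  · rw [h, hx.2, hy.2, ← add_mul, hab, one_mul]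

theorem finite_image_LD : (toReal '' {α | α ∈ LD G F}).Finite := by
  classical
  refine Set.Finite.image _ (((LD G F).toFinset.finite_toSet).subset fun α hα => ?_)
  simpa using hα

theorem toReal_mem_genPermZ_cutBound
    (h : cutBound (arcsWithoutZero G) (intDegDiff G F) univ = ∑ v, intDegDiff G F v)
    {α : Fin n → ℤ} :
    toReal α ∈ genPermZ (fun I => (cutBound (arcsWithoutZero G) (intDegDiff G F) I : ℝ)) ↔
      α ∈ LD G F := by
  rw [mem_genPermZ_cutBound h, mem_LD_iff]
  exact dominatesCuts_intCast

/-- Each linear functional is minimized over the polytope at a greedy base, which is integral and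
hence in `LD(G,F)`. -/
theorem convexHull_LD
    (h : cutBound (arcsWithoutZero G) (intDegDiff G F) univ = ∑ v, intDegDiff G F v) :
    convexHull ℝ (toReal '' {α | α ∈ LD G F}) =
      genPermZ (fun I => (cutBound (arcsWithoutZero G) (intDegDiff G F) I : ℝ)) := by
  refine subset_antisymm (convexHull_min ?_ (convex_genPermZ _)) ?_
  · rintro _ ⟨α, hα, rfl⟩
    exact (toReal_mem_genPermZ_cutBound h).2 hα
  · refine subset_convexHull_of_forall_exists_le finite_image_LD fun c => ?_
    obtain ⟨y, hy, _, hmin⟩ := exists_base_minimizing _ (cutBound_empty _ _)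
      (cutBound_supermodular (arcsWithoutZero G) (intDegDiff G F)) c
    exact ⟨toReal y, ⟨y, (toReal_mem_genPermZ_cutBound h).1 hy, rfl⟩, hmin⟩

theorem flows_nonempty_iff (hF : F ⊆ arcsWithoutZero G) :
    (flows G F).Nonempty ↔
      cutBound (arcsWithoutZero G) (intDegDiff G F) univ = ∑ v, intDegDiff G F v := by
  rw [← Set.image_nonempty (f := fun f i => f (some i, none)), image_flows hF]
  constructor
  · rintro ⟨x, hx⟩
    exact DominatesCuts.cutBound_univ hx
  · intro h
    -- The zero cost is arbitrary: any base will do.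
    obtain ⟨y, hy, _⟩ := exists_base_minimizing _ (cutBound_empty _ _)
      (cutBound_supermodular (arcsWithoutZero G) (intDegDiff G F)) 0
    exact ⟨toReal y, (mem_genPermZ_cutBound h).1 hy⟩

theorem isLeast_sinkValues (hF : F ⊆ arcsWithoutZero G)
    (h : cutBound (arcsWithoutZero G) (intDegDiff G F) univ = ∑ v, intDegDiff G F v)
    (I : Finset (Fin n)) :
    IsLeast (sinkValues G F I) (cutBound (arcsWithoutZero G) (intDegDiff G F) I : ℝ) := by
  have h1 : sinkValues G F I = (fun x => ∑ i ∈ I, x i) ''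
      genPermZ (fun I => (cutBound (arcsWithoutZero G) (intDegDiff G F) I : ℝ)) := by
    have h2 : genPermZ (fun I => (cutBound (arcsWithoutZero G) (intDegDiff G F) I : ℝ)) =
        (fun f i => f (some i, none)) '' flows G F := by
      rw [image_flows hF]
      ext x
      exact mem_genPermZ_cutBound h
    rw [h2, Set.image_image]
    rfl
  rw [h1]
  constructor
  · obtain ⟨y, hy, hy', _⟩ := exists_base_minimizing _ (cutBound_empty _ _)
      (cutBound_supermodular (arcsWithoutZero G) (intDegDiff G F)) (fun i => if i ∈ I then 1 else 0)
    refine ⟨toReal y, hy, ?_⟩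
    have h3 : univ.filter (fun i => (0 : ℝ) < if i ∈ I then 1 else 0) = I := by
      ext i
      by_cases hi : i ∈ I <;> simp [hi]
    have h4 := hy' 0
    rw [h3] at h4
    simp only [toReal]
    exact_mod_cast h4
  · rintro _ ⟨x, hx, rfl⟩
    rcases eq_or_ne I univ with rfl | hI
    · exact hx.2.ge
    · exact hx.1 I hI

theorem zParam_eq (hF : F ⊆ arcsWithoutZero G)
    (h : cutBound (arcsWithoutZero G) (intDegDiff G F) univ = ∑ v, intDegDiff G F v) :
    zParam G F = fun I => (cutBound (arcsWithoutZero G) (intDegDiff G F) I : ℝ) :=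
  funext fun I => (isLeast_sinkValues hF h I).csInf_eq

/-! ### Minkowski sums of simplices -/

theorem mem_reachable {i k : Fin n} :
    k ∈ reachable G i ↔ Relation.ReflTransGen (fun u v => (u, v) ∈ arcsWithoutZero G) i k := by
  simp [reachable]

theorem self_mem_reachable (i : Fin n) : i ∈ reachable G i :=
  mem_reachable.2 Relation.ReflTransGen.refl

theorem outClosed_reachable (i : Fin n) : OutClosed (arcsWithoutZero G) (reachable G i) :=
  fun _ he h => mem_reachable.2 ((mem_reachable.1 h).tail he)

theorem OutClosed.reachable_subset {J : Finset (Fin n)} (hJ : OutClosed (arcsWithoutZero G) J)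
    {i : Fin n} (hi : i ∈ J) : reachable G i ⊆ J := by
  intro k hk
  induction mem_reachable.1 hk with
  | refl => exact hi
  | tail h1 h2 ih => exact hJ _ h2 (ih (mem_reachable.2 h1))

theorem le_of_mem_reachable {i k : Fin n} (h : k ∈ reachable G i) : i ≤ k := by
  induction mem_reachable.1 h with
  | refl => exact le_rfl
  | tail h1 h2 ih => exact (ih (mem_reachable.2 h1)).trans (fst_lt_snd h2).le

theorem reachable_injective : Function.Injective (reachable G) := by
  intro i j h
  refine le_antisymm (le_of_mem_reachable (G := G) ?_) (le_of_mem_reachable (G := G) ?_)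
  · rw [h]; exact self_mem_reachable j
  · rw [← h]; exact self_mem_reachable i

theorem simplexFace_of_nonempty {I : Finset (Fin n)} (hI : I.Nonempty) :
    simplexFace I = convexHull ℝ ((fun i => Pi.single i (1 : ℝ)) '' (I : Set (Fin n))) :=
  if_neg hI.ne_empty

theorem simplexFace_nonempty (I : Finset (Fin n)) : (simplexFace I).Nonempty := by
  rcases I.eq_empty_or_nonempty with rfl | hI
  · simp [simplexFace]
  · rw [simplexFace_of_nonempty hI]
    exact (Set.Nonempty.image _ hI).convexHull

theorem minkowskiSum_eq_convexHull :
    minkowskiSum G F = convexHull ℝ (∑ i : Fin n, degDiff G F i •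
      ((fun j => Pi.single j (1 : ℝ)) '' (reachable G i : Set (Fin n)) : Set (Fin n → ℝ))) := by
  rw [minkowskiSum, convexHull_sum]
  refine sum_congr rfl fun i _ => ?_
  rw [convexHull_smul, simplexFace_of_nonempty ⟨i, self_mem_reachable i⟩]

/-- A vertex choice in the sum moves `b_i` from `i` to some `m i ∈ δ(i)`; supply starting in a
closed set stays there. For the converse, choose `m i` cheapest in `δ(i)` for a given cost. -/
theorem minkowskiSum_eq_genPermZ (hb : ∀ i, outdeg F i ≤ indeg G i)
    (h : cutBound (arcsWithoutZero G) (intDegDiff G F) univ = ∑ v, intDegDiff G F v) :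
    minkowskiSum G F =
      genPermZ (fun I => (cutBound (arcsWithoutZero G) (intDegDiff G F) I : ℝ)) := by
  have hb' : ∀ i, 0 ≤ degDiff G F i := fun i => by
    have := hb i
    simp only [degDiff, sub_nonneg]
    exact_mod_cast this
  rw [minkowskiSum_eq_convexHull]
  refine subset_antisymm (convexHull_min ?_ (convex_genPermZ _)) ?_
  · intro x hx
    obtain ⟨t, ht, rfl⟩ := (Set.mem_finsetSum _ _ _).1 hx
    have ht' : ∀ i, ∃ m ∈ reachable G i, t i = degDiff G F i • Pi.single m (1 : ℝ) := fun i => by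
      obtain ⟨_, ⟨m, hm, rfl⟩, h⟩ := ht (mem_univ i)
      exact ⟨m, hm, h.symm⟩
    choose m hm htm using ht'
    have hsum : ∀ J : Finset (Fin n), ∑ v ∈ J, (∑ i, t i) v =
        ∑ i, if m i ∈ J then degDiff G F i else 0 := by
      intro J
      simp only [Finset.sum_apply, htm]
      rw [sum_comm]
      refine sum_congr rfl fun i _ => ?_
      simp [Pi.single_apply]
    refine (mem_genPermZ_cutBound h).2 ⟨fun v => ?_, fun J hJ => ?_, ?_⟩
    · rw [← sum_singleton (∑ i, t i) v, hsum]
      exact sum_nonneg fun i _ => by split_ifs <;> simp [hb']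
    · rw [hsum, ← univ_inter J, ← sum_ite_mem]
      refine sum_le_sum fun i _ => ?_
      rw [intCast_intDegDiff, univ_inter]
      by_cases hi : i ∈ J
      · rw [if_pos hi, if_pos (hJ.reachable_subset hi (hm i))]
      · rw [if_neg hi]
        split_ifs <;> simp [hb']
    · rw [hsum]
      simp [intCast_intDegDiff]
  · refine subset_convexHull_of_forall_exists_le ?_ fun c => ?_
    · exact sum_induction _ Set.Finite (fun _ _ => Set.Finite.add) Set.finite_zero fun i _ =>
        ((Set.toFinite _).image _).smul_set
    · have hmin : ∀ i, ∃ j ∈ reachable G i, ∀ k ∈ reachable G i, c j ≤ c k := fun i =>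
        exists_min_image _ c ⟨i, self_mem_reachable i⟩
      choose m hm hm' using hmin
      refine ⟨∑ i, degDiff G F i • Pi.single (m i) (1 : ℝ), ?_, fun x hx => ?_⟩
      · exact Set.finsetSum_mem_finsetSum _ _ _ fun i _ =>
          Set.smul_mem_smul_set ⟨m i, hm i, rfl⟩
      · obtain ⟨hx0, g, hg, hgx⟩ := dominatesCuts_iff.1 ((mem_genPermZ_cutBound h).1 hx)
        have h1 : ∑ i, c i * (∑ j, degDiff G F j • Pi.single (m j) (1 : ℝ) : Fin n → ℝ) i =
            ∑ j, c (m j) * degDiff G F j := by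
          simp only [Finset.sum_apply, mul_sum]
          rw [sum_comm]
          refine sum_congr rfl fun j _ => ?_
          simp [Pi.single_apply]
        -- Weak duality: `c ∘ m` does not decrease along arcs, because `δ` of the head lies in `δ`
        -- of the tail.
        have h2 := sum_mul_excess (arcsWithoutZero G) g fun i => c (m i)
        have h3 : ∑ e ∈ arcsWithoutZero G, g e * (c (m e.1) - c (m e.2)) ≤ 0 := by
          refine sum_nonpos fun e he => mul_nonpos_of_nonneg_of_nonpos (hg e he) (sub_nonpos.2 ?_)
          refine hm' _ _ ((outClosed_reachable e.1).reachable_subset ?_ (hm e.2))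
          exact outClosed_reachable e.1 e he (self_mem_reachable e.1)
        have h4 : ∑ i, c (m i) * x i ≤ ∑ i, c i * x i := sum_le_sum fun i _ =>
          mul_le_mul_of_nonneg_right (hm' i i (self_mem_reachable i)) (hx0 i)
        simp only [hgx, intCast_intDegDiff, mul_sub, sum_sub_distrib] at h2
        rw [h1]
        simp only [mul_sub, sum_sub_distrib] at h3
        linarith

/-- If `A` covers `A'` with difference `{k}`, then `A = A' ∪ δ(k)`, and irreducibility forces `A =
δ(k)`. Conversely, any closed set containing `k` contains `δ(k)`, and `δ(k) \ {k}` is closed because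
arcs increase. -/
theorem joinIrreducible_iff {J : Finset (Fin n)} {k : Fin n} :
    (∃ A A' : closedSets G, (A : Finset (Fin n)) = J ∧ SupIrred A ∧ A' ⋖ A ∧
      (A : Finset (Fin n)) \ (A' : Finset (Fin n)) = {k}) ↔ reachable G k = J := by
  have hmem : ∀ J : Finset (Fin n), J ∈ closedSets G ↔ OutClosed (arcsWithoutZero G) J :=
    fun J => outdegSet_eq_zero G J
  constructor
  · rintro ⟨A, A', rfl, hA, hcov, hk⟩
    have hk1 : k ∈ (A : Finset (Fin n)) \ (A' : Finset (Fin n)) := by rw [hk]; exact mem_singleton_self k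
    obtain ⟨hkA, hkA'⟩ := mem_sdiff.1 hk1
    let D : closedSets G := ⟨reachable G k, (hmem _).2 (outClosed_reachable k)⟩
    have hDA : reachable G k ⊆ (A : Finset (Fin n)) :=
      ((hmem _).1 A.2).reachable_subset hkA
    have hA'A : (A' : Finset (Fin n)) ⊆ A := hcov.lt.le
    have hsup : A' ⊔ D = A := by
      apply Subtype.ext
      change (A' : Finset (Fin n)) ∪ reachable G k = A
      refine subset_antisymm (union_subset hA'A hDA) fun j hj => ?_
      by_cases hj' : j ∈ (A' : Finset (Fin n))
      · exact mem_union_left _ hj'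
      · have : j ∈ (A : Finset (Fin n)) \ (A' : Finset (Fin n)) := mem_sdiff.2 ⟨hj, hj'⟩
        rw [hk, mem_singleton] at this
        rw [this]
        exact mem_union_right _ (self_mem_reachable k)
    rcases hA.2 hsup with h | h
    · exact absurd h hcov.lt.ne
    · exact congrArg Subtype.val h
  · rintro rfl
    have hE : OutClosed (arcsWithoutZero G) ((reachable G k).erase k) := by
      intro e he h
      have h1 := mem_of_mem_erase h
      refine mem_erase.2 ⟨?_, outClosed_reachable k e he h1⟩
      exact ((le_of_mem_reachable h1).trans_lt (fst_lt_snd he)).ne'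
    have hss : (reachable G k).erase k ⊂ reachable G k := erase_ssubset (self_mem_reachable k)
    refine ⟨⟨reachable G k, (hmem _).2 (outClosed_reachable k)⟩,
      ⟨(reachable G k).erase k, (hmem _).2 hE⟩, rfl, ⟨?_, ?_⟩, ⟨hss, ?_⟩, ?_⟩
    · intro hmin
      exact absurd (hmin (b := ⟨(reachable G k).erase k, (hmem _).2 hE⟩) hss.le) hss.not_ge
    · intro B C hBC
      have h1 : (B : Finset (Fin n)) ∪ (C : Finset (Fin n)) = reachable G k := congrArg Subtype.val hBC
      have h2 : k ∈ (B : Finset (Fin n)) ∪ (C : Finset (Fin n)) := by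
        rw [h1]; exact self_mem_reachable k
      refine (mem_union.1 h2).imp (fun h => Subtype.ext ?_) (fun h => Subtype.ext ?_)
      · exact subset_antisymm (subset_union_left.trans_eq h1) (((hmem _).1 B.2).reachable_subset h)
      · exact subset_antisymm (subset_union_right.trans_eq h1) (((hmem _).1 C.2).reachable_subset h)
    · intro B hB1 hB2
      have h1 : (reachable G k).erase k ⊂ (B : Finset (Fin n)) := hB1
      have h2 : (B : Finset (Fin n)) ⊂ reachable G k := hB2
      have h3 := card_lt_card h1
      have h4 := card_lt_card h2
      rw [card_erase_of_mem (self_mem_reachable k)] at h3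
      omega
    · exact sdiff_erase_self (self_mem_reachable k)

theorem genPermY_yParam : genPermY (yParam G F) = minkowskiSum G F := by
  classical
  have hy : ∀ J, yParam G F J = ∑ k, if reachable G k = J then degDiff G F k else 0 := by
    intro J
    rw [yParam]
    refine sum_congr rfl fun k _ => ?_
    by_cases hJ : reachable G k = J
    · rw [if_pos hJ, if_pos (joinIrreducible_iff.2 hJ)]
    · rw [if_neg hJ, if_neg fun h => hJ (joinIrreducible_iff.1 h)]
  rw [genPermY, minkowskiSum, ← sum_subset (subset_univ (univ.image (reachable G)))]
  · rw [sum_image reachable_injective.injOn]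
    refine sum_congr rfl fun i _ => ?_
    rw [hy]
    simp [reachable_injective.eq_iff]
  · intro J _ hJ
    have h0 : yParam G F J = 0 := by
      rw [hy]
      refine sum_eq_zero fun k _ => if_neg fun h => hJ ?_
      exact mem_image.2 ⟨k, mem_univ k, h⟩
    -- Nonemptiness matters: scaling by `0` gives `{0}`, neutral for Minkowski sums, whereas the
    -- empty set would stay empty.
    rw [h0, Set.zero_smul_set (simplexFace_nonempty J)]

theorem cutBound_univ_of_nonneg (hb : ∀ i, outdeg F i ≤ indeg G i) :
    cutBound (arcsWithoutZero G) (intDegDiff G F) univ = ∑ v, intDegDiff G F v := by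
  have hb' : ∀ i, 0 ≤ intDegDiff G F i := fun i => by
    have := hb i
    simp only [intDegDiff]
    omega
  -- Each vertex sends its whole supply straight to the sink.
  exact DominatesCuts.cutBound_univ (R := ℤ) (x := intDegDiff G F)
    ⟨hb', fun J _ => by simp, by simp⟩

end

end LeftDegree

theorem mainTheorem6 (n : ℕ) (G : SimpleGraph (Fin (n + 1))) (F : Finset (Fin n × Fin n))
    (hF : F ⊆ arcsWithoutZero G) :
    newton (leftDegreePoly G F) = convexHull ℝ (toReal '' {α | α ∈ LD G F}) ∧
    HasPolytopalSupport (leftDegreePoly G F) ∧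
    (¬ (flows G F).Nonempty → LD G F = 0) ∧
    ((flows G F).Nonempty →
      (∀ I, IsLeast (sinkValues G F I) (zParam G F I)) ∧
      IsGenPermParam (zParam G F) ∧
      newton (leftDegreePoly G F) = genPermZ (zParam G F) ∧
      ∀ α : Fin n → ℤ, toReal α ∈ genPermZ (zParam G F) → α ∈ LD G F) ∧
    ((∀ i, outdeg F i ≤ indeg G i) →
      (flows G F).Nonempty ∧
      genPermY (yParam G F) = genPermZ (zParam G F) ∧
      newton (leftDegreePoly G F) = minkowskiSum G F) := by
  have hmem : ∀ α ∈ LD G F,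
      cutBound (arcsWithoutZero G) (intDegDiff G F) Finset.univ = ∑ v, intDegDiff G F v :=
    fun α hα => DominatesCuts.cutBound_univ (R := ℤ) ((mem_LD_iff α).1 hα)
  refine ⟨newton_leftDegreePoly, fun α hα => ?_, fun h => ?_, fun h => ?_, fun hb => ?_⟩
  · rw [newton_leftDegreePoly] at hα
    -- A point of the Newton polytope forces `LD(G,F)` to be nonempty, which supplies the flow
    -- criterion.
    obtain ⟨_, ⟨β, hβ, rfl⟩⟩ := convexHull_nonempty_iff.1 ⟨_, hα⟩
    have h := hmem β hβ
    rw [convexHull_LD h, toReal_mem_genPermZ_cutBound h] at hα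
    have h0 := ((mem_LD_iff α).1 hα).1
    have h1 : (fun i => (((Finsupp.equivFunOnFinite.symm fun i => (α i).toNat) : Fin n →₀ ℕ) i : ℤ))
        = α := by
      funext i
      simp [h0 i]
    refine ⟨Finsupp.equivFunOnFinite.symm fun i => (α i).toNat, ?_, congrFun h1⟩
    rw [coeff_leftDegreePoly_ne_zero, h1]
    exact hα
  · refine Multiset.eq_zero_of_forall_notMem fun α hα => h ?_
    exact (flows_nonempty_iff hF).2 (hmem α hα)
  · have hu := (flows_nonempty_iff hF).1 h
    rw [newton_leftDegreePoly, convexHull_LD hu, zParam_eq hF hu]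
    refine ⟨isLeast_sinkValues hF hu, ⟨?_, fun I J => ?_⟩, rfl,
      fun α => (toReal_mem_genPermZ_cutBound hu).1⟩
    · simp [cutBound_empty]
    · simp only
      exact_mod_cast cutBound_supermodular (arcsWithoutZero G) (intDegDiff G F) I J
  · have hu := cutBound_univ_of_nonneg hb
    rw [newton_leftDegreePoly, convexHull_LD hu, zParam_eq hF hu, genPermY_yParam,
      minkowskiSum_eq_genPermZ hb hu]
    exact ⟨(flows_nonempty_iff hF).2 hu, rfl, rfl⟩
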